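/- For $n\ge 1$ let $B_n^+$ be the monoid of positive $n$-strand braids, with generators $\sigma_1,\dots,\sigma_{n-1}$ and relations $\sigma_i\sigma_j=\sigma_j\sigma_i$ for $|i-j|\ge 2$ and $\sigma_i\sigma_j\sigma_i=\sigma_j\sigma_i\sigma_j$ for $|i-j|=1$. Let $\Delta_1=1$ and $\Delta_n=\sigma_1\sigma_2\cdots\sigma_{n-1}\Delta_{n-1}$, and call the left divisors of $\Delta_n$ simple. A sequence $(x_1,\dots,x_d)$ of simple braids is normal if $x_k$ is the greatest common left divisor of $\Delta_n$ and $x_k\cdots x_d$ for each $k$. Every $y\in B_n^+$ is the product of a normal sequence, unique once it is completed on the right by infinitely many factors $1$; this is the normal form of $y$, and $y$ has degree at most $d$ if all factors after the $d$th one are $1$. For $d\ge 1$ let $b_{n,d}$ be the number of $y\in B_n^+$ of degree at most $d$ and, for $x$ simple, let $b_{n,d}(x)$ be the number of those whose $d$th factor is $x$. Let $D_L(x)$ (resp. $D_R(x)$) be the set of the $i$ such that $\sigma_i$ is a left (resp. right) divisor of $x$. For $I\subseteq\{1,\dots,n-1\}$, the $n$-composition of $I$ is $(p_1,p_2-p_1,\dots,p_k-p_{k-1})$,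 where $p_1<\dots<p_k$ enumerates $\{1,\dots,n\}\setminus I$, and the $n$-partition of $I$ is its non-increasing rearrangement. The partition of a simple braid $x$ is the $n$-partition of $D_L(x)$. For a partition $\mu$ of $n$, let $\widetilde\mu$ be the unique set whose $n$-composition is $\mu$ (read as a non-increasing sequence). Let $\overline M_n$ be the matrix indexed by partitions of $n$ whose $(\lambda,\mu)$-entry is the number of simple $n$-braids $x$ with partition $\lambda$ and with $D_R(x)\supseteq\widetilde\mu$. Assume $n=3$. Then: 1. The matrix $\overline M_3$ is invertible over $\mathbb Q$, with eigenvalues $1$ (double) and $2$, i.e., its characteristic polynomial is $(X-1)^2(X-2)$. 2. The only simple $3$-braid with partition $(1,1,1)$ is $1$; those with partition $(2,1)$ are exactly $\sigma_1,\sigma_2,\sigma_2\sigma_1,\sigma_1\sigma_2$; the only one with partition $(3)$ is $\Delta_3$. 3. For every $d\ge 1$ and every simple $3$-braid $x$, $$b_{3,d}(x)=\begin{cases}4\cdot 2^d-3d-4 & \text{if } x \text{ has partition } (1,1,1),\\ 2^d-1 & \text{if } x \text{ has partition } (2,1),\\ 1 & \text{if } x \text{ has partition } (3),\end{cases}$$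 and $b_{3,d}=8\cdot 2^d-3d-7$. -/

import Mathlib

namespace PosBraid

/-- The braid relations on words in the letters `σ_1, …, σ_{n-1}`; the letter `σ_{i+1}` is
represented by `i : Fin (n - 1)`. -/
inductive Rel (n : ℕ) : FreeMonoid (Fin (n - 1)) → FreeMonoid (Fin (n - 1)) → Prop
  | comm (i j : Fin (n - 1)) (h : (i : ℕ) + 2 ≤ j ∨ (j : ℕ) + 2 ≤ i) :
      Rel n (FreeMonoid.of i * FreeMonoid.of j) (FreeMonoid.of j * FreeMonoid.of i)
  | braid (i j : Fin (n - 1)) (h : (i : ℕ) + 1 = j ∨ (j : ℕ) + 1 = i) :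
      Rel n (FreeMonoid.of i * FreeMonoid.of j * FreeMonoid.of i)
        (FreeMonoid.of j * FreeMonoid.of i * FreeMonoid.of j)

end PosBraid

/-- The monoid `B_n^+` of positive `n`-strand braids. In this monoid `x ∣ y` means that `x` is a
left divisor of `y`. -/
abbrev PosBraid (n : ℕ) : Type := PresentedMonoid (PosBraid.Rel n)

namespace PosBraid

/-- The generator `σ_{i+1}` of `B_n^+`. -/
def σ {n : ℕ} (i : Fin (n - 1)) : PosBraid n := PresentedMonoid.of (Rel n) i

/-- The braid `Δ_k`, seen in `B_n^+` for `k ≤ n`, given by `Δ_0 = 1` and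
`Δ_{k+1} = σ_1 σ_2 ⋯ σ_k Δ_k` (so that `Δ_1 = 1`). -/
def deltaIn (n : ℕ) : (k : ℕ) → k ≤ n → PosBraid n
  | 0, _ => 1
  | k + 1, h =>
      (List.ofFn fun i : Fin k => σ (n := n) ⟨i, by omega⟩).prod * deltaIn n k (by omega)

/-- The braid `Δ_n` of `B_n^+`. -/
def Δ (n : ℕ) : PosBraid n := deltaIn n n le_rfl

/-- `x` is a right divisor of `y`. -/
def RightDvd {n : ℕ} (x y : PosBraid n) : Prop := ∃ z, y = z * x

/-- The simple braids are the (left) divisors of `Δ_n`. -/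
def IsSimple {n : ℕ} (x : PosBraid n) : Prop := x ∣ Δ n

/-- `g` is the greatest common left divisor of `a` and `b`. -/
def IsLeftGcd {n : ℕ} (g a b : PosBraid n) : Prop :=
  g ∣ a ∧ g ∣ b ∧ ∀ h, h ∣ a → h ∣ b → h ∣ g

/-- A sequence `(x_1, …, x_d)` of simple braids is normal if `x_k = gcd(Δ_n, x_k ⋯ x_d)` holds
for each `k`. -/
def IsNormalSeq {n : ℕ} (s : List (PosBraid n)) : Prop :=
  (∀ x ∈ s, IsSimple x) ∧
    ∀ (k : ℕ) (hk : k < s.length), IsLeftGcd s[k] (Δ n) (s.drop k).prod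

/-- `f` is the normal form of `y`, completed on the right by infinitely many trivial factors;
`f k` is the `(k+1)`st factor. -/
def IsNormalForm {n : ℕ} (y : PosBraid n) (f : ℕ → PosBraid n) : Prop :=
  ∃ r : ℕ, IsNormalSeq (List.ofFn fun k : Fin r => f k) ∧
    (List.ofFn fun k : Fin r => f k).prod = y ∧ ∀ k, r ≤ k → f k = 1

/-- `y` has degree at most `d`: all factors of its normal form after the `d`th one are trivial. -/
def HasDegreeLE {n : ℕ} (y : PosBraid n) (d : ℕ) : Prop :=
  ∃ f, IsNormalForm y f ∧ ∀ k, d ≤ k → f k = 1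

/-- For `d ≥ 1`: the `d`th factor of the normal form of `y` is `x`. -/
def HasFactor {n : ℕ} (y : PosBraid n) (d : ℕ) (x : PosBraid n) : Prop :=
  ∃ f, IsNormalForm y f ∧ f (d - 1) = x

/-- `b_{n,d}`: the number of positive `n`-strand braids of degree at most `d`. -/
noncomputable def b (n d : ℕ) : ℕ := {y : PosBraid n | HasDegreeLE y d}.ncard

/-- `b_{n,d}(x)`: the number of positive `n`-strand braids of degree at most `d` whose `d`th
factor is `x`. -/
noncomputable def bAt (n d : ℕ) (x : PosBraid n) : ℕ :=
  {y : PosBraid n | HasDegreeLE y d ∧ HasFactor y d x}.ncard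

open Classical in
/-- `D_L(x)`: the `i` such that `σ_i` is a left divisor of `x` (shifted by one). -/
noncomputable def DL {n : ℕ} (x : PosBraid n) : Finset (Fin (n - 1)) :=
  Finset.univ.filter fun i => σ i ∣ x

open Classical in
/-- `D_R(x)`: the `i` such that `σ_i` is a right divisor of `x` (shifted by one). -/
noncomputable def DR {n : ℕ} (x : PosBraid n) : Finset (Fin (n - 1)) :=
  Finset.univ.filter fun i => RightDvd (σ i) x

/-- The bijection sending a subset `I` of `{1, …, n-1}` (shifted by one) to the composition
`(p_1, p_2 - p_1, …, p_k - p_{k-1})` of `n`, where `p_1 < ⋯ < p_k` enumerates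
`{1, …, n} \ I`. -/
def compEquiv (n : ℕ) : Finset (Fin (n - 1)) ≃ Composition n :=
  ((Function.Involutive.toPerm (compl : Finset (Fin (n - 1)) → Finset (Fin (n - 1)))
      compl_involutive).trans (compositionAsSetEquiv n).symm).trans (compositionEquiv n).symm

/-- The `n`-partition of `I`: the rearrangement of the `n`-composition of `I`. -/
def part {n : ℕ} (I : Finset (Fin (n - 1))) : n.Partition :=
  Nat.Partition.ofComposition n (compEquiv n I)

/-- The composition of `n` that lists the parts of a partition in non-increasing order. -/
def sortedComp {n : ℕ} (μ : n.Partition) : Composition n where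
  blocks := μ.parts.sort (· ≥ ·)
  blocks_pos := fun h => μ.parts_pos ((Multiset.mem_sort _).1 h)
  blocks_sum := by
    rw [← Multiset.sum_coe, Multiset.sort_eq, μ.parts_sum]

/-- The unique subset of `{1, …, n-1}` (shifted by one) whose `n`-composition is `μ`, read as a
non-increasing sequence. -/
def tilde {n : ℕ} (μ : n.Partition) : Finset (Fin (n - 1)) :=
  (compEquiv n).symm (sortedComp μ)

/-- The reduced incidence matrix indexed by partitions of `n`: its `(lam, μ)`-entry is the number
of simple `n`-braids `x` such that `D_L(x)` has `n`-partition `lam` and `D_R(x)` contains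
`tilde μ`. -/
noncomputable def Mbar (n : ℕ) : Matrix n.Partition n.Partition ℚ :=
  Matrix.of fun lam μ =>
    ({x : PosBraid n | IsSimple x ∧ part (DL x) = lam ∧ tilde μ ⊆ DR x}.ncard : ℚ)

end PosBraid

namespace PosBraid

/-! ### Compositions and partitions attached to subsets of `{1, 2}` -/

/-! The proof rests on two facts about `PosBraid 3`: left cancellation, and that a braid left
divisible by both generators is left divisible by `Δ 3`. Both are read off a concrete model. Pairs
`(k, w)`, with `w` a word without factor `aba` (`a ≠ b`), stand for `Δ ^ k * w`, and the generators
act on them by injective maps that satisfy the braid relation (`act_braid`, `act_injective`). Acting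
on the empty pair gives `nf`, which has the left inverse `ofModel`, so the model is faithful.

With these facts there are six simple braids, and the gcd condition becomes local
(`isLeftGcd_Δ_mul_iff`, `isNormalSeq_iff`): a sequence of simple braids is normal iff `DL y ⊆ DR x`
for all consecutive `x`, `y`. Braids of degree at most `d` thus correspond to walks with `d`
vertices in an explicit graph on six vertices. Counting them by last vertex gives a linear
recursion, solved in `card_seqs`. In the order `(1,1,1)`, `(2,1)`, `(3)` the matrix `Mbar 3` is
lower triangular with diagonal `1, 2, 1`, whence its characteristic polynomial. -/

/-- A composition guessed in advance is certified by evaluating only the inverse of `compEquiv`. -/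
theorem part_eq_of_symm {n : ℕ} {c : Composition n} {I : Finset (Fin (n - 1))}
    (h : (compEquiv n).symm c = I) : part I = Nat.Partition.ofComposition n c := by
  rw [part, ← h, Equiv.apply_symm_apply]

theorem parts_part_empty : (part (n := 3) ∅).parts = {1, 1, 1} := by
  rw [part_eq_of_symm (c := ⟨[1, 1, 1], by decide, by decide⟩) (by decide)]; rfl

theorem parts_part_zero : (part (n := 3) {0}).parts = {2, 1} := by
  rw [part_eq_of_symm (c := ⟨[2, 1], by decide, by decide⟩) (by decide)]; rfl

theorem parts_part_one : (part (n := 3) {1}).parts = {2, 1} := by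
  rw [part_eq_of_symm (c := ⟨[1, 2], by decide, by decide⟩) (by decide)]
  decide

theorem parts_part_univ : (part (n := 3) {0, 1}).parts = {3} := by
  rw [part_eq_of_symm (c := ⟨[3], by decide, by decide⟩) (by decide)]; rfl

theorem sortedComp_blocks_eq {n : ℕ} {μ : n.Partition} {l : List ℕ} (h : μ.parts = ↑l)
    (hl : l.Pairwise (· ≥ ·)) : (sortedComp μ).blocks = l := by
  refine List.Perm.eq_of_pairwise' (r := (· ≥ ·)) (Multiset.pairwise_sort _ _) hl ?_
  rw [← Multiset.coe_eq_coe, ← h]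
  exact Multiset.sort_eq _ _

theorem tilde_eq_of_parts {n : ℕ} {μ : n.Partition} {c : Composition n}
    (h : μ.parts = ↑c.blocks) (hl : c.blocks.Pairwise (· ≥ ·)) :
    tilde μ = (compEquiv n).symm c := by
  rw [tilde, Composition.ext (sortedComp_blocks_eq h hl)]

theorem tilde_part_empty : tilde (part (n := 3) ∅) = ∅ := by
  rw [tilde_eq_of_parts (c := ⟨[1, 1, 1], by decide, by decide⟩) parts_part_empty (by simp)]
  decide

theorem tilde_part_zero : tilde (part (n := 3) {0}) = {0} := by
  rw [tilde_eq_of_parts (c := ⟨[2, 1], by decide, by decide⟩) parts_part_zero (by simp)]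
  decide

theorem tilde_part_univ : tilde (part (n := 3) {0, 1}) = {0, 1} := by
  rw [tilde_eq_of_parts (c := ⟨[3], by decide, by decide⟩) parts_part_univ (by simp)]
  decide

theorem part_surjective (n : ℕ) : Function.Surjective (part (n := n)) :=
  Nat.Partition.ofComposition_surj.comp (compEquiv n).surjective

/-- The compositions `(1, 2)` and `(2, 1)` have the same rearrangement; this is the only coincidence
among the four subsets. -/
theorem part_one_eq_part_zero : part (n := 3) {1} = part {0} :=
  Nat.Partition.ext (parts_part_one.trans parts_part_zero.symm)

/-- The partitions `(1, 1, 1)`, `(2, 1)` and `(3)`. -/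
def partitionThree (i : Fin 3) : Nat.Partition 3 :=
  part (![∅, {0}, {0, 1}] i)

theorem parts_partitionThree (i : Fin 3) :
    (partitionThree i).parts = (![{1, 1, 1}, {2, 1}, {3}] : Fin 3 → Multiset ℕ) i := by
  fin_cases i
  exacts [parts_part_empty, parts_part_zero, parts_part_univ]

theorem partitionThree_bijective : Function.Bijective partitionThree := by
  constructor
  · intro i j h
    have h' := congrArg Nat.Partition.parts h
    rw [parts_partitionThree, parts_partitionThree] at h'
    clear h
    revert i j
    decide
  · intro μ
    obtain ⟨I, rfl⟩ := part_surjective 3 μ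
    have hI : ∀ I : Finset (Fin 2), I = ∅ ∨ I = {0} ∨ I = {1} ∨ I = {0, 1} := by decide
    rcases hI I with rfl | rfl | rfl | rfl
    · exact ⟨0, rfl⟩
    · exact ⟨1, rfl⟩
    · exact ⟨1, part_one_eq_part_zero.symm⟩
    · exact ⟨2, rfl⟩

/-! ### Basic facts on positive braids -/

theorem induction_on {n : ℕ} {p : PosBraid n → Prop} (y : PosBraid n) (one : p 1)
    (mul : ∀ i y, p y → p (σ i * y)) : p y := by
  induction y using PresentedMonoid.inductionOn with
  | _ w =>
    induction w using FreeMonoid.inductionOn' with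
    | one => exact one
    | of_mul i w ih => rw [map_mul]; exact mul i _ ih

/-- The length of a positive braid. -/
def length {n : ℕ} : PosBraid n →* Multiplicative ℕ :=
  PresentedMonoid.lift (fun _ => Multiplicative.ofAdd 1) (by
    rintro _ _ (⟨i, j, -⟩ | ⟨i, j, -⟩) <;> simp)

theorem eq_one_or_σ_mul {n : ℕ} (y : PosBraid n) : y = 1 ∨ ∃ i z, y = σ i * z := by
  induction y using induction_on with
  | one => exact .inl rfl
  | mul i y _ => exact .inr ⟨i, y, rfl⟩

theorem braid_relation : (σ 0 * σ 1 * σ 0 : PosBraid 3) = σ 1 * σ 0 * σ 1 :=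
  PresentedMonoid.mk_eq_mk_of_rel (Rel.braid (n := 3) 0 1 (.inl rfl))

theorem Δ_three : Δ 3 = σ 0 * σ 1 * σ 0 := by
  simp [Δ, deltaIn, List.ofFn_succ]

theorem Δ_three' : Δ 3 = σ 1 * σ 0 * σ 1 := Δ_three.trans braid_relation

/-! ### A faithful model of the monoid of positive `3`-braids

A positive `3`-braid is uniquely `Δ ^ k * w` with `w` a word in which neither
`σ₁σ₂σ₁` nor `σ₂σ₁σ₂` occurs. -/

/-- The words in two letters that have no factor of the form `aba` with `a ≠ b`. -/
def IsReduced : List Bool → Prop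
  | a :: b :: c :: w => (a = b ∨ b = c) ∧ IsReduced (b :: c :: w)
  | _ => True

theorem IsReduced.tail {a : Bool} {w : List Bool} (h : IsReduced (a :: w)) : IsReduced w := by
  rcases w with _ | ⟨b, _ | ⟨c, w⟩⟩
  · trivial
  · trivial
  · exact h.2

/-- Multiplication of a reduced word by a letter, with the power of `Δ` that is split off. -/
def consWord (k : ℕ) (a : Bool) : List Bool → ℕ × List Bool
  | b :: c :: w => if b ≠ a ∧ c = a then (k + 1, w) else (k, a :: b :: c :: w)
  | w => (k, a :: w)

theorem isReduced_consWord (k : ℕ) (a : Bool) {w : List Bool} (h : IsReduced w) :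
    IsReduced (consWord k a w).2 := by
  rcases w with _ | ⟨b, _ | ⟨c, w⟩⟩
  · trivial
  · trivial
  · rw [consWord]
    split_ifs with hc
    · exact h.tail.tail
    · refine ⟨?_, h⟩
      revert hc; cases a <;> cases b <;> cases c <;> simp

/-- The set of the pairs `(k, w)` standing for the braids `Δ ^ k * w`. -/
abbrev Model : Type := {p : ℕ × List Bool // IsReduced p.2}

/-- The letter that is moved to `a` by a jump over `Δ ^ k`. -/
def twist (k : ℕ) (a : Bool) : Bool := xor a k.bodd

/-- Left multiplication by a generator in the model. -/
def act (a : Bool) (p : Model) : Model :=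
  ⟨consWord p.1.1 (twist p.1.1 a) p.1.2, isReduced_consWord _ _ p.2⟩

/-- The result does not depend on `a`, so this yields the braid relation for the action; it also
says that `Δ` acts by raising the exponent. -/
theorem act_braid (a : Bool) (p : Model) :
    act a (act (!a) (act a p)) = ⟨(p.1.1 + 1, p.1.2), p.2⟩ := by
  obtain ⟨⟨k, w⟩, h⟩ := p
  apply Subtype.ext
  have hw : IsReduced w := h
  -- The three multiplications depend on at most the first four letters of `w`.
  rcases w with _ | ⟨b, _ | ⟨c, _ | ⟨d, _ | ⟨e, w⟩⟩⟩⟩ <;> cases hk : k.bodd <;> cases a <;>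
    (try cases b) <;> (try cases c) <;> (try cases d) <;> (try cases e) <;>
    simp_all [act, consWord, twist, IsReduced]

/-- By `act_braid`, `act a` is the innermost factor of a composite that only raises the exponent,
hence is injective. -/
theorem act_injective (a : Bool) : Function.Injective (act a) := by
  refine Function.Injective.of_comp (f := fun p => act a (act (!a) p)) ?_
  intro p q h
  simp only [Function.comp_apply, act_braid, Subtype.mk.injEq, Prod.mk.injEq,
    Nat.add_right_cancel_iff] at h
  exact Subtype.ext (Prod.ext h.1 h.2)

/-- A final exponent zero means that no `Δ` was split off or jumped over, so the letter was put in
front unchanged. -/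
theorem head?_act {a : Bool} {p : Model} (h : (act a p).1.1 = 0) :
    (act a p).1.2.head? = some a := by
  obtain ⟨⟨k, w⟩, hw⟩ := p
  revert h
  rcases w with _ | ⟨b, _ | ⟨c, w⟩⟩
  · rintro rfl
    simp [act, consWord, twist]
  · rintro rfl
    simp [act, consWord, twist]
  · simp only [act, consWord]
    split_ifs
    · simp
    · rintro rfl
      simp [twist]

/-- The generators of the monoid of `3`-braids, indexed by the letters of the model. -/
def gen (a : Bool) : PosBraid 3 := if a then σ 1 else σ 0

theorem gen_braid (a : Bool) : gen a * gen (!a) * gen a = Δ 3 := by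
  cases a
  · exact Δ_three.symm
  · exact Δ_three'.symm

theorem gen_mul_Δ (a : Bool) : gen a * Δ 3 = Δ 3 * gen (!a) := by
  conv_rhs => rw [← gen_braid a]
  conv_lhs => rw [← gen_braid (!a), Bool.not_not]
  simp only [mul_assoc]

theorem gen_mul_Δ_pow (a : Bool) (k : ℕ) :
    gen a * Δ 3 ^ k = Δ 3 ^ k * gen (twist k a) := by
  induction k with
  | zero => simp [twist]
  | succ k ih =>
    rw [pow_succ, ← mul_assoc, ih, mul_assoc, gen_mul_Δ, ← mul_assoc]
    congr 2
    simp [twist]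

/-- The action of a generator on the model. -/
def actGen (i : Fin (3 - 1)) : Function.End Model := act (i = 1)

/-- The action of the braid monoid on the model. -/
def actHom : PosBraid 3 →* Function.End Model :=
  PresentedMonoid.lift actGen (by
    rintro _ _ (⟨i, j, hij⟩ | ⟨i, j, hij⟩)
    -- The commutation relations are vacuous, as there are only two generators.
    · omega
    · have h : ∀ a p, act a (act (!a) (act a p)) = act (!a) (act a (act (!a) p)) := by
        intro a p
        rw [act_braid]
        -- Writing the middle letter as `!!a` makes the right-hand side an instance of `act_braid`
        -- at `!a`.
        conv_rhs => rw [← Bool.not_not a, Bool.not_not (!a), act_braid]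
      funext p
      simp only [map_mul, FreeMonoid.lift_eval_of]
      fin_cases i <;> fin_cases j
      · simp at hij
      · exact h false p
      · exact h true p
      · simp at hij)

/-- The normal form in the model. -/
def nf (y : PosBraid 3) : Model := actHom y ⟨(0, []), trivial⟩

theorem nf_gen_mul (a : Bool) (y : PosBraid 3) : nf (gen a * y) = act a (nf y) := by
  have h : actHom (gen a) = act a := by
    cases a <;> exact PresentedMonoid.lift_of ..
  rw [nf, map_mul, h]
  rfl

/-- The braid represented by an element of the model. -/
def ofModel (p : Model) : PosBraid 3 := Δ 3 ^ p.1.1 * (p.1.2.map gen).prod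

theorem ofModel_act (a : Bool) (p : Model) : ofModel (act a p) = gen a * ofModel p := by
  obtain ⟨⟨k, w⟩, hw⟩ := p
  rw [ofModel, ofModel, ← mul_assoc, gen_mul_Δ_pow]
  rcases w with _ | ⟨b, _ | ⟨c, w⟩⟩
  · simp [act, consWord]
  · simp [act, consWord, mul_assoc]
  · simp only [act, consWord]
    split_ifs with h
    · obtain ⟨hb, rfl⟩ := h
      obtain rfl : b = !twist k a := by revert hb; cases b <;> cases twist k a <;> simp
      rw [pow_succ, ← gen_braid (twist k a)]
      simp [mul_assoc]
    · simp [mul_assoc]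

theorem σ_eq_gen (i : Fin (3 - 1)) : σ i = gen (i = 1) := by
  fin_cases i <;> rfl

/-- Hence `nf` is injective, which lets cancellation pass from the model to the monoid. -/
theorem ofModel_nf (y : PosBraid 3) : ofModel (nf y) = y := by
  induction y using induction_on with
  | one =>
    rw [nf, map_one]
    simp [ofModel, Function.End.one_def]
  | mul i y ih => rw [σ_eq_gen, nf_gen_mul, ofModel_act, ih]

theorem σ_mul_left_cancel {i : Fin (3 - 1)} {y z : PosBraid 3} (h : σ i * y = σ i * z) :
    y = z := by
  rw [σ_eq_gen] at h
  have h' := act_injective _ ((nf_gen_mul _ y).symm.trans ((congrArg nf h).trans (nf_gen_mul _ z)))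
  rw [← ofModel_nf y, h', ofModel_nf]

theorem left_cancel {x y z : PosBraid 3} (h : x * y = x * z) : y = z := by
  induction x using induction_on with
  | one => simpa using h
  | mul i x ih => exact ih (σ_mul_left_cancel (by simpa only [mul_assoc] using h))

/-- If the exponent of `nf y` were zero, its word would begin with both letters by `head?_act`. -/
theorem Δ_dvd_of_σ_dvd {y : PosBraid 3} (h0 : σ 0 ∣ y) (h1 : σ 1 ∣ y) : Δ 3 ∣ y := by
  obtain ⟨u, hu⟩ := h0
  obtain ⟨v, hv⟩ := h1
  have hu' : nf y = act false (nf u) := by rw [hu]; exact nf_gen_mul false u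
  have hv' : nf y = act true (nf v) := by rw [hv]; exact nf_gen_mul true v
  have hk : (nf y).1.1 ≠ 0 := by
    intro hk
    have h0 := head?_act (hu' ▸ hk)
    have h1 := head?_act (hv' ▸ hk)
    rw [← hu'] at h0
    rw [← hv', h0] at h1
    simp at h1
  rw [← ofModel_nf y]
  exact (dvd_pow_self _ hk).mul_right _

/-! ### Divisors of `Δ` -/

theorem dvd_of_mul_dvd_mul_left {x y z : PosBraid 3} (h : x * y ∣ x * z) : y ∣ z := by
  obtain ⟨w, hw⟩ := h
  exact ⟨w, left_cancel (hw.trans (mul_assoc _ _ _))⟩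

theorem eq_one_or_gen_mul (y : PosBraid 3) : y = 1 ∨ ∃ a z, y = gen a * z := by
  rcases eq_one_or_σ_mul y with h | ⟨i, z, h⟩
  · exact .inl h
  · exact .inr ⟨_, z, h.trans (by rw [σ_eq_gen])⟩

theorem length_gen (a : Bool) : length (gen a) = Multiplicative.ofAdd 1 := by
  cases a <;> rfl

/-- The length of a `3`-braid, as a natural number. -/
def len (y : PosBraid 3) : ℕ := Multiplicative.toAdd (length y)

@[simp] theorem len_one : len 1 = 0 := by simp [len]

@[simp] theorem len_mul (x y : PosBraid 3) : len (x * y) = len x + len y := by simp [len]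

@[simp] theorem len_gen (a : Bool) : len (gen a) = 1 := by simp [len, length_gen]

@[simp] theorem len_Δ : len (Δ 3) = 3 := by simp [← gen_braid true]

theorem eq_one_of_len {y : PosBraid 3} (h : len y = 0) : y = 1 := by
  rcases eq_one_or_gen_mul y with rfl | ⟨a, z, rfl⟩
  · rfl
  · simp at h

theorem eq_gen_of_len {y : PosBraid 3} (h : len y = 1) : ∃ a, y = gen a := by
  rcases eq_one_or_gen_mul y with rfl | ⟨a, z, rfl⟩
  · simp at h
  · refine ⟨a, ?_⟩
    rw [eq_one_of_len (y := z) (by simpa using h), mul_one]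

theorem len_le_of_dvd {x y : PosBraid 3} (h : x ∣ y) : len x ≤ len y := by
  obtain ⟨z, rfl⟩ := h
  simp

theorem Δ_dvd_of_gen_dvd {y : PosBraid 3} {a : Bool} (h : gen a ∣ y) (h' : gen (!a) ∣ y) :
    Δ 3 ∣ y := by
  cases a
  · exact Δ_dvd_of_σ_dvd h h'
  · exact Δ_dvd_of_σ_dvd h' h

theorem not_gen_dvd_one (a : Bool) : ¬ gen a ∣ (1 : PosBraid 3) :=
  fun h => by simpa using len_le_of_dvd h

/-- Two distinct generators dividing `y` would force `Δ`, of length 3, to divide it. -/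
theorem eq_of_gen_dvd_of_len_lt {y : PosBraid 3} {a b : Bool} (ha : gen a ∣ y) (hb : gen b ∣ y)
    (hy : len y < 3) : a = b := by
  by_contra hab
  obtain rfl : b = !a := by revert hab; cases a <;> cases b <;> simp
  have := len_le_of_dvd (Δ_dvd_of_gen_dvd ha hb)
  simp at this
  omega

theorem gen_injective : Function.Injective gen := fun a b h =>
  eq_of_gen_dvd_of_len_lt (y := gen a) dvd_rfl (h ▸ dvd_rfl) (by simp)

theorem dvd_gen {x : PosBraid 3} {a : Bool} (h : x ∣ gen a) : x = 1 ∨ x = gen a := by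
  rcases eq_one_or_gen_mul x with rfl | ⟨b, z, rfl⟩
  · exact .inl rfl
  · have hl := len_le_of_dvd h
    obtain rfl : b = a :=
      eq_of_gen_dvd_of_len_lt ((dvd_mul_right _ _).trans h) dvd_rfl (by simp)
    rw [eq_one_of_len (y := z) (by simpa using hl), mul_one]
    exact .inr rfl

theorem dvd_gen_mul_gen {x : PosBraid 3} {a b : Bool} (h : x ∣ gen a * gen b) :
    x = 1 ∨ x = gen a ∨ x = gen a * gen b := by
  rcases eq_one_or_gen_mul x with rfl | ⟨c, z, rfl⟩
  · exact .inl rfl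
  · obtain rfl : c = a :=
      eq_of_gen_dvd_of_len_lt ((dvd_mul_right _ _).trans h) (dvd_mul_right _ _) (by simp)
    rcases dvd_gen (dvd_of_mul_dvd_mul_left h) with rfl | rfl
    · simp
    · simp

theorem gen_mul_gen_dvd_Δ (a : Bool) : gen a * gen (!a) ∣ Δ 3 := ⟨gen a, (gen_braid a).symm⟩

theorem gen_dvd_Δ (a : Bool) : gen a ∣ Δ 3 := (dvd_mul_right _ _).trans (gen_mul_gen_dvd_Δ a)

theorem IsSimple.cases {x : PosBraid 3} (h : IsSimple x) :
    x = 1 ∨ (∃ a, x = gen a) ∨ (∃ a, x = gen a * gen (!a)) ∨ x = Δ 3 := by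
  rcases eq_one_or_gen_mul x with rfl | ⟨a, z, rfl⟩
  · exact .inl rfl
  · rw [IsSimple, ← gen_braid a, mul_assoc] at h
    rcases dvd_gen_mul_gen (dvd_of_mul_dvd_mul_left h) with rfl | rfl | rfl
    · exact .inr (.inl ⟨a, mul_one _⟩)
    · exact .inr (.inr (.inl ⟨a, rfl⟩))
    · exact .inr (.inr (.inr (by rw [← mul_assoc, gen_braid])))

/-! ### Right divisors of simple braids -/

theorem rightDvd_gen_one (a : Bool) : ¬ RightDvd (gen a) 1 := by
  rintro ⟨z, hz⟩
  simpa using congrArg len hz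

theorem rightDvd_gen_gen {a b : Bool} : RightDvd (gen a) (gen b) ↔ a = b := by
  constructor
  · rintro ⟨z, hz⟩
    have hl := congrArg len hz
    rw [eq_one_of_len (y := z) (by simpa using hl), one_mul] at hz
    exact gen_injective hz.symm
  · rintro rfl
    exact ⟨1, (one_mul _).symm⟩

theorem rightDvd_gen_gen_mul_gen {a b : Bool} : RightDvd (gen a) (gen (!b) * gen b) ↔ a = b := by
  constructor
  · rintro ⟨z, hz⟩
    have hl := congrArg len hz
    obtain ⟨c, rfl⟩ := eq_gen_of_len (y := z) (by simpa using hl)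
    obtain rfl : c = !b :=
      eq_of_gen_dvd_of_len_lt (y := gen c * gen a) (dvd_mul_right _ _) (hz ▸ dvd_mul_right _ _)
        (by simp)
    exact gen_injective (left_cancel hz).symm
  · rintro rfl
    exact ⟨_, rfl⟩

theorem rightDvd_gen_Δ (a : Bool) : RightDvd (gen a) (Δ 3) := ⟨_, (gen_braid a).symm⟩

/-- This is what makes a non-maximal simple prefix extendable in the gcd criterion below. -/
theorem mul_gen_dvd_Δ {x : PosBraid 3} (hx : IsSimple x) {a : Bool}
    (h : ¬ RightDvd (gen a) x) : x * gen a ∣ Δ 3 := by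
  rcases hx.cases with rfl | ⟨b, rfl⟩ | ⟨b, rfl⟩ | rfl
  · rw [one_mul]
    exact gen_dvd_Δ a
  · obtain rfl : a = !b := by
      rw [rightDvd_gen_gen] at h
      revert h; cases a <;> cases b <;> simp
    exact gen_mul_gen_dvd_Δ b
  · obtain rfl : a = b := by
      have h := mt (rightDvd_gen_gen_mul_gen (b := !b)).2 (by rwa [Bool.not_not])
      revert h; cases a <;> cases b <;> simp
    rw [gen_braid]
  · exact absurd (rightDvd_gen_Δ a) h

theorem gen_mul_gen_dvd_of_gen_dvd {a : Bool} {m : PosBraid 3} (h : gen (!a) ∣ gen a * m) :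
    gen (!a) * gen a ∣ m := by
  have := Δ_dvd_of_gen_dvd (dvd_mul_right _ _) h
  rw [← gen_braid a, mul_assoc] at this
  exact dvd_of_mul_dvd_mul_left this

/-- If `gen a` divides `m` but does not divide `x` on the right, then `x * gen a` is a longer simple
divisor of `x * m`. Conversely, for each of the simple `x`, a simple divisor `g` of `x * m` not
dividing `x` would make a forbidden generator divide `m`. -/
theorem isLeftGcd_Δ_mul_iff {x m : PosBraid 3} (hx : IsSimple x) :
    IsLeftGcd x (Δ 3) (x * m) ↔ ∀ a, gen a ∣ m → RightDvd (gen a) x := by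
  constructor
  · rintro ⟨-, -, h⟩ a ha
    by_contra hna
    have := h _ (mul_gen_dvd_Δ hx hna) (mul_dvd_mul_left x ha)
    exact not_gen_dvd_one a (dvd_of_mul_dvd_mul_left (x := x) (by rwa [mul_one]))
  · intro h
    refine ⟨hx, dvd_mul_right _ _, fun g hg hgm => ?_⟩
    rcases hx.cases with rfl | ⟨b, rfl⟩ | ⟨b, rfl⟩ | rfl
    · rcases eq_one_or_gen_mul g with rfl | ⟨a, z, rfl⟩
      · rfl
      · rw [one_mul] at hgm
        exact absurd (h a ((dvd_mul_right _ _).trans hgm)) (rightDvd_gen_one a)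
    · have hb : ¬ gen (!b) ∣ m := fun hm => by simpa using rightDvd_gen_gen.1 (h _ hm)
      -- If `g` began with the other letter, `Δ` would divide `gen b * m`, and cancelling `gen b`
      -- would contradict `hb`. So `g` can only begin with `b`.
      have hg' : ¬ gen (!b) ∣ g := fun hgb =>
        hb ((dvd_mul_right _ _).trans (gen_mul_gen_dvd_of_gen_dvd (hgb.trans hgm)))
      rcases IsSimple.cases hg with rfl | ⟨a, rfl⟩ | ⟨a, rfl⟩ | rfl
      · exact one_dvd _
      · obtain rfl : a = b := by
          by_contra hab
          exact hg' (by rw [show (!b) = a by revert hab; cases a <;> cases b <;> simp])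
        rfl
      · obtain rfl : a = b := by
          by_contra hab
          exact hg' (by rw [show (!b) = a by revert hab; cases a <;> cases b <;> simp]
                        exact dvd_mul_right _ _)
        exact absurd (dvd_of_mul_dvd_mul_left hgm) hb
      · exact absurd (gen_dvd_Δ _) hg'
    · have hb : ¬ gen b ∣ m := fun hm => by
        have := (rightDvd_gen_gen_mul_gen (b := !b)).1 (by simpa using h _ hm)
        simp at this
      have hg' : ¬ gen (!b) ∣ g := fun hgb => by
        have h1 := gen_mul_gen_dvd_of_gen_dvd (hgb.trans (hgm.trans (mul_assoc _ _ _).dvd))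
        exact hb (dvd_of_mul_dvd_mul_left h1)
      rcases IsSimple.cases hg with rfl | ⟨a, rfl⟩ | ⟨a, rfl⟩ | rfl
      · exact one_dvd _
      · obtain rfl : a = b := by
          by_contra hab
          exact hg' (by rw [show (!b) = a by revert hab; cases a <;> cases b <;> simp])
        exact dvd_mul_right _ _
      · obtain rfl : a = b := by
          by_contra hab
          exact hg' (by rw [show (!b) = a by revert hab; cases a <;> cases b <;> simp]
                        exact dvd_mul_right _ _)
        rfl
      · exact absurd (gen_dvd_Δ _) hg'
    · exact hg

theorem dvd_antisymm_braid {x y : PosBraid 3} (h : x ∣ y) (h' : y ∣ x) : x = y := by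
  obtain ⟨z, rfl⟩ := h
  have := len_le_of_dvd h'
  rw [eq_one_of_len (y := z) (by simpa using this), mul_one]

theorem IsLeftGcd.unique {x x' y z : PosBraid 3} (h : IsLeftGcd x y z) (h' : IsLeftGcd x' y z) :
    x = x' :=
  dvd_antisymm_braid (h'.2.2 _ h.1 h.2.1) (h.2.2 _ h'.1 h'.2.1)

/-! ### Normal sequences -/

/-- The pairs of simple braids that can be consecutive in a normal sequence. -/
def CanFollow (x y : PosBraid 3) : Prop := ∀ a, gen a ∣ y → RightDvd (gen a) x

theorem isNormalSeq_cons {x : PosBraid 3} {l : List (PosBraid 3)} :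
    IsNormalSeq (x :: l) ↔ IsSimple x ∧ IsLeftGcd x (Δ 3) (x * l.prod) ∧ IsNormalSeq l := by
  constructor
  · rintro ⟨h1, h2⟩
    refine ⟨h1 x (by simp), h2 0 (Nat.succ_pos _), fun y hy => h1 y (by simp [hy]),
      fun k hk => h2 (k + 1) (Nat.succ_lt_succ hk)⟩
  · rintro ⟨h1, h2, h3, h4⟩
    refine ⟨by simpa using ⟨h1, h3⟩, fun k hk => ?_⟩
    rcases k with _ | k
    · exact h2
    · exact h4 k (Nat.lt_of_succ_lt_succ hk)

theorem isNormalSeq_nil : IsNormalSeq ([] : List (PosBraid 3)) :=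
  ⟨by simp, fun k hk => absurd hk (by simp)⟩

/-- The gcd condition involves the whole remaining product; it becomes a condition on neighbours
because, in a normal sequence, the first factor already has all the generators that divide the
product. -/
theorem isNormalSeq_iff {l : List (PosBraid 3)} :
    IsNormalSeq l ↔ (∀ x ∈ l, IsSimple x) ∧ l.IsChain CanFollow := by
  induction l with
  | nil => simp [isNormalSeq_nil]
  | cons x l ih =>
    rw [isNormalSeq_cons, List.isChain_cons, List.forall_mem_cons]
    by_cases hx : IsSimple x
    swap
    · simp [hx]
    by_cases hl : IsNormalSeq l
    swap
    · have := mt ih.2 hl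
      tauto
    have key : IsLeftGcd x (Δ 3) (x * l.prod) ↔ ∀ y ∈ l.head?, CanFollow x y := by
      rw [isLeftGcd_Δ_mul_iff hx]
      rcases l with _ | ⟨y, l⟩
      · simp [not_gen_dvd_one]
      · have hy := (isNormalSeq_cons.1 hl).2.1
        simp only [List.head?_cons, Option.mem_def, Option.some.injEq, forall_eq', CanFollow,
          List.prod_cons]
        -- Each generator divides `Δ`, so it divides the remaining product iff it divides the gcd
        -- `y`.
        exact forall_congr' fun a => imp_congr_left
          ⟨fun h => hy.2.2 _ (gen_dvd_Δ a) h, fun h => h.mul_right _⟩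
    have := ih.1 hl
    tauto

/-- The first factor is determined as a gcd and can be cancelled. Equal lengths are required because
normal sequences may end in factors `1`. -/
theorem IsNormalSeq.eq_of_prod_eq {l l' : List (PosBraid 3)} (h : IsNormalSeq l)
    (h' : IsNormalSeq l') (hl : l.length = l'.length) (hp : l.prod = l'.prod) : l = l' := by
  induction l generalizing l' with
  | nil => exact (List.length_eq_zero_iff.1 hl.symm).symm
  | cons x l ih =>
    rcases l' with _ | ⟨x', l'⟩
    · simp at hl
    · rw [isNormalSeq_cons] at h h'
      rw [List.prod_cons, List.prod_cons] at hp
      obtain rfl : x = x' := h.2.1.unique (hp ▸ h'.2.1)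
      rw [ih h.2.2 h'.2.2 (by simpa using hl) (left_cancel hp)]

/-! ### The six simple `3`-braids -/

theorem gen_dvd_gen {a b : Bool} : gen a ∣ gen b ↔ a = b :=
  ⟨fun h => eq_of_gen_dvd_of_len_lt h dvd_rfl (by simp), fun h => h ▸ dvd_rfl⟩

theorem gen_dvd_gen_mul_gen {a b c : Bool} : gen a ∣ gen b * gen c ↔ a = b :=
  ⟨fun h => eq_of_gen_dvd_of_len_lt h (dvd_mul_right _ _) (by simp),
    fun h => h ▸ dvd_mul_right _ _⟩

/-- The list of the simple `3`-braids. -/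
def simple : Fin 6 → PosBraid 3 :=
  ![1, σ 0, σ 1, σ 1 * σ 0, σ 0 * σ 1, Δ 3]

/-- The left descent sets of the simple `3`-braids. -/
def leftDescent : Fin 6 → Finset (Fin 2) := ![∅, {0}, {1}, {1}, {0}, {0, 1}]

/-- The right descent sets of the simple `3`-braids. -/
def rightDescent : Fin 6 → Finset (Fin 2) := ![∅, {0}, {1}, {0}, {1}, {0, 1}]

theorem σ_zero_eq_gen : (σ 0 : PosBraid 3) = gen false := rfl

theorem σ_one_eq_gen : (σ 1 : PosBraid 3) = gen true := rfl

theorem isSimple_simple (s : Fin 6) : IsSimple (simple s) := by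
  fin_cases s
  exacts [one_dvd _, gen_dvd_Δ false, gen_dvd_Δ true, gen_mul_gen_dvd_Δ true,
    gen_mul_gen_dvd_Δ false, dvd_rfl]

theorem isSimple_iff {x : PosBraid 3} : IsSimple x ↔ ∃ s, simple s = x := by
  constructor
  · intro h
    rcases h.cases with rfl | ⟨_ | _, rfl⟩ | ⟨_ | _, rfl⟩ | rfl
    exacts [⟨0, rfl⟩, ⟨1, rfl⟩, ⟨2, rfl⟩, ⟨4, rfl⟩, ⟨3, rfl⟩, ⟨5, rfl⟩]
  · rintro ⟨s, rfl⟩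
    exact isSimple_simple s

theorem mem_DL {n : ℕ} {x : PosBraid n} {i : Fin (n - 1)} : i ∈ DL x ↔ σ i ∣ x := by
  simp [DL]

theorem mem_DR {n : ℕ} {x : PosBraid n} {i : Fin (n - 1)} : i ∈ DR x ↔ RightDvd (σ i) x := by
  simp [DR]

theorem DL_simple (s : Fin 6) : DL (simple s) = leftDescent s := by
  refine Finset.ext (Fin.forall_fin_two.2
    ⟨(mem_DL (n := 3) (i := 0)).trans ?_, (mem_DL (n := 3) (i := 1)).trans ?_⟩) <;>
  fin_cases s <;>
    simp [simple, leftDescent, σ_zero_eq_gen, σ_one_eq_gen, gen_dvd_gen,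
      gen_dvd_gen_mul_gen, not_gen_dvd_one, gen_dvd_Δ]

theorem DR_simple (s : Fin 6) : DR (simple s) = rightDescent s := by
  have h0 (a : Bool) : RightDvd (gen a) (gen false * gen true) ↔ a = true :=
    rightDvd_gen_gen_mul_gen (b := true)
  have h1 (a : Bool) : RightDvd (gen a) (gen true * gen false) ↔ a = false :=
    rightDvd_gen_gen_mul_gen (b := false)
  refine Finset.ext (Fin.forall_fin_two.2
    ⟨(mem_DR (n := 3) (i := 0)).trans ?_, (mem_DR (n := 3) (i := 1)).trans ?_⟩) <;>
  fin_cases s <;>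
    simp [simple, rightDescent, σ_zero_eq_gen, σ_one_eq_gen, rightDvd_gen_gen, h0, h1,
      rightDvd_gen_one, rightDvd_gen_Δ]

theorem simple_injective : Function.Injective simple := by
  intro s t h
  have hl := congrArg DL h
  have hr := congrArg DR h
  rw [DL_simple, DL_simple] at hl
  rw [DR_simple, DR_simple] at hr
  clear h
  revert s t
  decide

theorem canFollow_iff {x y : PosBraid 3} : CanFollow x y ↔ DL y ⊆ DR x := by
  constructor
  · intro h i hi
    rw [mem_DL, σ_eq_gen] at hi
    rw [mem_DR, σ_eq_gen]
    exact h _ hi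
  · rintro h (_ | _) ha
    · exact mem_DR.1 (h (mem_DL.2 ha))
    · exact mem_DR.1 (h (mem_DL.2 ha))

/-- The pairs of simple `3`-braids that can be consecutive in a normal sequence. -/
def Follow (s t : Fin 6) : Prop := leftDescent t ⊆ rightDescent s

instance : DecidableRel Follow := fun s t => decidable_of_iff (leftDescent t ⊆ rightDescent s) .rfl

theorem canFollow_simple {s t : Fin 6} : CanFollow (simple s) (simple t) ↔ Follow s t := by
  rw [canFollow_iff, DL_simple, DR_simple, Follow]

/-! ### Normal forms as lists -/

theorem ofFn_fin_eq_map_range {α : Type*} (f : ℕ → α) (r : ℕ) :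
    (List.ofFn fun k : Fin r => f k) = (List.range r).map f := by
  apply List.ext_getElem <;> simp

theorem IsNormalForm.isSimple {y : PosBraid 3} {f : ℕ → PosBraid 3} (h : IsNormalForm y f)
    (k : ℕ) : IsSimple (f k) := by
  obtain ⟨r, hr, -, h1⟩ := h
  rcases lt_or_ge k r with hk | hk
  · exact hr.1 _ (List.mem_ofFn.2 ⟨⟨k, hk⟩, rfl⟩)
  · rw [h1 k hk]
    exact one_dvd _

theorem IsNormalForm.canFollow {y : PosBraid 3} {f : ℕ → PosBraid 3} (h : IsNormalForm y f)
    (k : ℕ) : CanFollow (f k) (f (k + 1)) := by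
  obtain ⟨r, hr, -, h1⟩ := h
  rcases lt_or_ge (k + 1) r with hk | hk
  · have := List.isChain_iff_getElem.1 (isNormalSeq_iff.1 hr).2 k (by simpa using hk)
    simpa using this
  · rw [h1 _ hk]
    exact fun a ha => absurd ha (not_gen_dvd_one a)

theorem IsNormalForm.isNormalSeq {y : PosBraid 3} {f : ℕ → PosBraid 3} (h : IsNormalForm y f)
    (d : ℕ) : IsNormalSeq ((List.range d).map f) := by
  refine isNormalSeq_iff.2 ⟨?_, List.isChain_iff_getElem.2 fun k hk => ?_⟩
  · simp only [List.mem_map, forall_exists_index, and_imp]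
    rintro _ k - rfl
    exact h.isSimple k
  · simpa using h.canFollow k

theorem prod_map_range_of_le {M : Type*} [Monoid M] {f : ℕ → M} {r d : ℕ}
    (h : ∀ k, r ≤ k → f k = 1) (hd : r ≤ d) :
    ((List.range d).map f).prod = ((List.range r).map f).prod := by
  induction d, hd using Nat.le_induction with
  | base => rfl
  | succ d hd ih => simp [List.range_succ, ih, h d hd]

theorem IsNormalForm.prod_eq {y : PosBraid 3} {f : ℕ → PosBraid 3} (h : IsNormalForm y f)
    {d : ℕ} (hd : ∀ k, d ≤ k → f k = 1) : ((List.range d).map f).prod = y := by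
  obtain ⟨r, -, rfl, h1⟩ := h
  rw [ofFn_fin_eq_map_range, ← prod_map_range_of_le hd (le_max_left d r),
    prod_map_range_of_le h1 (le_max_right d r)]

theorem IsNormalForm.unique {y : PosBraid 3} {f g : ℕ → PosBraid 3} (hf : IsNormalForm y f)
    (hg : IsNormalForm y g) : f = g := by
  obtain ⟨r, -, -, hr⟩ := id hf
  obtain ⟨t, -, -, ht⟩ := id hg
  have key (d : ℕ) (h1 : r ≤ d) (h2 : t ≤ d) : (List.range d).map f = (List.range d).map g :=
    (hf.isNormalSeq d).eq_of_prod_eq (hg.isNormalSeq d) (by simp) <| by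
      rw [hf.prod_eq fun k hk => hr k (h1.trans hk), hg.prod_eq fun k hk => ht k (h2.trans hk)]
  funext k
  -- This length exceeds the index `k` and both lengths `r` and `t` after which the factors are
  -- trivial.
  exact List.map_inj_left.1 (key (r + t + k + 1) (by omega) (by omega)) k
    (List.mem_range.2 (by omega))

/-- The default value `1` of `getD` supplies the infinitely many trivial factors. -/
theorem isNormalForm_getD {l : List (PosBraid 3)} (hl : IsNormalSeq l) :
    IsNormalForm l.prod (fun k => l.getD k 1) := by
  have : (List.ofFn fun k : Fin l.length => l.getD k 1) = l := by
    apply List.ext_getElem <;> simp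
  refine ⟨l.length, ?_, ?_, fun k hk => by simp [hk]⟩ <;> rw [this]
  exact hl

/-- Padding by `1` keeps a sequence normal, so degree at most `d` amounts to length exactly `d`. -/
theorem hasDegreeLE_iff {y : PosBraid 3} {d : ℕ} :
    HasDegreeLE y d ↔ ∃ l, IsNormalSeq l ∧ l.length = d ∧ l.prod = y := by
  constructor
  · rintro ⟨f, hf, hd⟩
    exact ⟨_, hf.isNormalSeq d, by simp, hf.prod_eq hd⟩
  · rintro ⟨l, hl, rfl, rfl⟩
    exact ⟨_, isNormalForm_getD hl, fun k hk => by simp [hk]⟩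

theorem hasDegreeLE_and_hasFactor_iff {y x : PosBraid 3} {d : ℕ} :
    HasDegreeLE y (d + 1) ∧ HasFactor y (d + 1) x ↔
      ∃ l, IsNormalSeq l ∧ l.length = d + 1 ∧ l.getLast? = some x ∧ l.prod = y := by
  constructor
  · rintro ⟨⟨f, hf, hd⟩, ⟨g, hg, rfl⟩⟩
    obtain rfl := hf.unique hg
    exact ⟨_, hf.isNormalSeq (d + 1), by simp, by simp [List.range_succ], hf.prod_eq hd⟩
  · rintro ⟨l, hl, hd, hx, rfl⟩
    refine ⟨hasDegreeLE_iff.2 ⟨l, hl, hd, rfl⟩, _, isNormalForm_getD hl, ?_⟩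
    rw [List.getLast?_eq_getElem?, hd, Nat.add_sub_cancel] at hx
    simp [List.getD_eq_getElem?_getD, hx]

/-! ### Counting normal sequences -/

/-- The reversed normal sequences of length `d + 1` with last entry `s`. -/
def seqs : ℕ → Fin 6 → Finset (List (Fin 6))
  | 0, s => {[s]}
  | d + 1, s => ((Finset.univ.filter (Follow · s)).biUnion (seqs d)).image (s :: ·)

theorem mem_seqs {d : ℕ} {s : Fin 6} {l : List (Fin 6)} :
    l ∈ seqs d s ↔ l.length = d + 1 ∧ l.head? = some s ∧ l.IsChain (fun t s => Follow s t) := by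
  induction d generalizing s l with
  | zero =>
    rcases l with _ | ⟨a, _ | ⟨b, l⟩⟩ <;> simp [seqs]
  | succ d ih =>
    rcases l with _ | ⟨a, l⟩
    · simp [seqs]
    simp only [seqs, Finset.mem_image, Finset.mem_biUnion, Finset.mem_filter, Finset.mem_univ,
      true_and, ih, List.cons.injEq, List.length_cons, List.head?_cons, Option.some.injEq,
      List.isChain_cons, Nat.add_right_cancel_iff]
    constructor
    · rintro ⟨_, ⟨t, hts, hl, ht, hc⟩, rfl, rfl⟩
      exact ⟨hl, rfl, by simpa [ht] using hts, hc⟩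
    · rintro ⟨hl, rfl, hts, hc⟩
      rcases l with _ | ⟨t, l⟩
      · simp at hl
      · exact ⟨_, ⟨t, hts t rfl, hl, rfl, hc⟩, rfl, rfl⟩

/-- This is the transfer-matrix recursion; the union is disjoint because the head of a list in `seqs
d t` is `t`. -/
theorem card_seqs_succ (d : ℕ) (s : Fin 6) :
    (seqs (d + 1) s).card = ∑ t with Follow t s, (seqs d t).card := by
  rw [seqs, Finset.card_image_of_injective _ (List.cons_injective), Finset.card_biUnion]
  intro t _ t' _ h
  refine Finset.disjoint_left.2 fun l hl hl' => h ?_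
  simpa using (mem_seqs.1 hl).2.1.symm.trans (mem_seqs.1 hl').2.1

theorem card_seqs (d : ℕ) (s : Fin 6) : ((seqs d s).card : ℤ) =
    (![4 * 2 ^ (d + 1) - 3 * (d + 1) - 4, 2 ^ (d + 1) - 1, 2 ^ (d + 1) - 1, 2 ^ (d + 1) - 1,
      2 ^ (d + 1) - 1, 1] : Fin 6 → ℤ) s := by
  induction d generalizing s with
  | zero => fin_cases s <;> simp [seqs]
  | succ d ih =>
    rw [card_seqs_succ, Finset.sum_filter]
    push_cast
    simp only [ih, Fin.sum_univ_six]
    -- Every simple braid may precede `1`, only `Δ` may precede `Δ`, and each of the other four is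
    -- preceded by two of those four or by `Δ`.
    fin_cases s <;> simp +decide <;> ring

/-- The product of a reversed sequence of simple braids. -/
def revProd (l : List (Fin 6)) : PosBraid 3 := (l.map simple).reverse.prod

theorem isNormalSeq_reverse_map {l : List (Fin 6)} :
    IsNormalSeq (l.map simple).reverse ↔ l.IsChain (fun t s => Follow s t) := by
  rw [isNormalSeq_iff, List.isChain_reverse, List.isChain_map]
  simp only [canFollow_simple, and_iff_right_iff_imp]
  intro _ x hx
  simp only [List.mem_reverse, List.mem_map] at hx
  obtain ⟨s, -, rfl⟩ := hx
  exact isSimple_simple s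

theorem exists_reverse_map {l : List (PosBraid 3)} (h : IsNormalSeq l) :
    ∃ l' : List (Fin 6), l = (l'.map simple).reverse := by
  have : l.reverse ∈ Set.range (List.map simple) := by
    rw [Set.range_list_map]
    intro x hx
    exact isSimple_iff.1 (h.1 x (List.mem_reverse.1 hx))
  obtain ⟨l', h'⟩ := this
  exact ⟨l', by rw [h', List.reverse_reverse]⟩

/-- Injectivity holds on the union over all last factors, as needed for `b`; `bAt` uses the
restriction to one of them. -/
theorem revProd_injOn (d : ℕ) : Set.InjOn revProd (Finset.univ.biUnion (seqs d)) := by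
  intro l hl l' hl' h
  simp only [Finset.coe_biUnion, Set.mem_iUnion, Finset.mem_coe] at hl hl'
  obtain ⟨s, -, hs⟩ := hl
  obtain ⟨s', -, hs'⟩ := hl'
  rw [mem_seqs] at hs hs'
  have := (isNormalSeq_reverse_map.2 hs.2.2).eq_of_prod_eq (isNormalSeq_reverse_map.2 hs'.2.2)
    (by simp [hs.1, hs'.1]) h
  exact List.map_injective_iff.2 simple_injective (List.reverse_injective this)

theorem setOf_hasDegreeLE_eq (d : ℕ) : {y : PosBraid 3 | HasDegreeLE y (d + 1)} =
    revProd '' (Finset.univ.biUnion (seqs d)) := by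
  ext y
  simp only [Set.mem_ofPred_eq, hasDegreeLE_iff, Set.mem_image, Finset.mem_coe, Finset.mem_biUnion,
    Finset.mem_univ, true_and, mem_seqs]
  constructor
  · rintro ⟨l, hl, hd, rfl⟩
    obtain ⟨l, rfl⟩ := exists_reverse_map hl
    rcases l with _ | ⟨s, l⟩
    · simp at hd
    · exact ⟨_, ⟨s, by simpa using hd, rfl, isNormalSeq_reverse_map.1 hl⟩, rfl⟩
  · rintro ⟨l, ⟨s, hl, -, hc⟩, rfl⟩
    exact ⟨_, isNormalSeq_reverse_map.2 hc, by simpa using hl, rfl⟩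

theorem setOf_hasFactor_eq (d : ℕ) (s : Fin 6) :
    {y : PosBraid 3 | HasDegreeLE y (d + 1) ∧ HasFactor y (d + 1) (simple s)} =
      revProd '' (seqs d s) := by
  ext y
  simp only [Set.mem_ofPred_eq, hasDegreeLE_and_hasFactor_iff, Set.mem_image, Finset.mem_coe,
    mem_seqs]
  constructor
  · rintro ⟨l, hl, hd, hx, rfl⟩
    obtain ⟨l, rfl⟩ := exists_reverse_map hl
    refine ⟨_, ⟨by simpa using hd, ?_, isNormalSeq_reverse_map.1 hl⟩, rfl⟩
    rw [List.getLast?_reverse, List.head?_map, Option.map_eq_some_iff] at hx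
    obtain ⟨t, ht, hts⟩ := hx
    rw [ht, simple_injective hts]
  · rintro ⟨l, ⟨hl, hs, hc⟩, rfl⟩
    exact ⟨_, isNormalSeq_reverse_map.2 hc, by simpa using hl, by simp [hs], rfl⟩

theorem bAt_simple (d : ℕ) (s : Fin 6) : bAt 3 (d + 1) (simple s) = (seqs d s).card := by
  have h : Set.InjOn revProd (seqs d s) := (revProd_injOn d).mono (Finset.coe_subset.2
    (Finset.subset_biUnion_of_mem (seqs d) (Finset.mem_univ s)))
  rw [bAt, setOf_hasFactor_eq, h.ncard_image, Set.ncard_coe_finset]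

theorem b_eq_sum (d : ℕ) : b 3 (d + 1) = ∑ s, (seqs d s).card := by
  rw [b, setOf_hasDegreeLE_eq, (revProd_injOn d).ncard_image, Set.ncard_coe_finset,
    Finset.card_biUnion]
  intro t _ t' _ h
  refine Finset.disjoint_left.2 fun l hl hl' => h ?_
  simpa using (mem_seqs.1 hl).2.1.symm.trans (mem_seqs.1 hl').2.1

theorem b_three (d : ℕ) : (b 3 (d + 1) : ℤ) = 8 * 2 ^ (d + 1) - 3 * (d + 1) - 7 := by
  rw [b_eq_sum]
  push_cast
  simp only [card_seqs, Fin.sum_univ_six]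
  simp
  ring

/-! ### The incidence matrix -/

theorem part_DL_simple (s : Fin 6) : part (DL (simple s)) =
    partitionThree ((![0, 1, 1, 1, 1, 2] : Fin 6 → Fin 3) s) := by
  rw [DL_simple]
  fin_cases s
  exacts [rfl, rfl, part_one_eq_part_zero, part_one_eq_part_zero, rfl, rfl]

theorem tilde_partitionThree (i : Fin 3) :
    tilde (partitionThree i) = (![∅, {0}, {0, 1}] : Fin 3 → Finset (Fin 2)) i := by
  fin_cases i
  exacts [tilde_part_empty, tilde_part_zero, tilde_part_univ]

/-- Both defining conditions become finite conditions on the index in `Fin 6`, so each entry is a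
decidable count. -/
theorem Mbar_partitionThree (i j : Fin 3) :
    Mbar 3 (partitionThree i) (partitionThree j) =
      (!![1, 0, 0; 4, 2, 0; 1, 1, 1] : Matrix (Fin 3) (Fin 3) ℚ) i j := by
  have : {x : PosBraid 3 | IsSimple x ∧ part (DL x) = partitionThree i ∧
      tilde (partitionThree j) ⊆ DR x} = simple '' (Finset.univ.filter fun s : Fin 6 =>
        (![0, 1, 1, 1, 1, 2] : Fin 6 → Fin 3) s = i ∧
          (![∅, {0}, {0, 1}] : Fin 3 → Finset (Fin 2)) j ⊆ rightDescent s) := by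
    ext x
    simp only [Set.mem_ofPred_eq, Set.mem_image, Finset.mem_coe, Finset.mem_filter,
      Finset.mem_univ, true_and, isSimple_iff]
    constructor
    · rintro ⟨⟨s, rfl⟩, h1, h2⟩
      rw [part_DL_simple] at h1
      rw [tilde_partitionThree, DR_simple] at h2
      exact ⟨s, ⟨partitionThree_bijective.1 h1, h2⟩, rfl⟩
    · rintro ⟨s, ⟨h1, h2⟩, rfl⟩
      refine ⟨⟨s, rfl⟩, by rw [part_DL_simple, h1], ?_⟩
      rw [tilde_partitionThree, DR_simple]
      exact h2
  rw [Mbar, Matrix.of_apply, this, Set.ncard_image_of_injective _ simple_injective,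
    Set.ncard_coe_finset]
  fin_cases i <;> fin_cases j <;> norm_num <;> decide

theorem Mbar_three_eq : Mbar 3 = Matrix.reindex (Equiv.ofBijective _ partitionThree_bijective)
    (Equiv.ofBijective _ partitionThree_bijective) !![1, 0, 0; 4, 2, 0; 1, 1, 1] := by
  ext lam μ
  obtain ⟨i, rfl⟩ := partitionThree_bijective.2 lam
  obtain ⟨j, rfl⟩ := partitionThree_bijective.2 μ
  rw [Mbar_partitionThree, Matrix.reindex_apply, Matrix.submatrix_apply,
    Equiv.ofBijective_symm_apply_apply, Equiv.ofBijective_symm_apply_apply]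

theorem charpoly_Mbar_three : (Mbar 3).charpoly =
    (Polynomial.X - Polynomial.C 1) ^ 2 * (Polynomial.X - Polynomial.C 2) := by
  rw [Mbar_three_eq, Matrix.charpoly_reindex, Matrix.charpoly, Matrix.det_fin_three]
  simp
  ring

theorem isUnit_Mbar_three : IsUnit (Mbar 3) := by
  rw [Matrix.isUnit_iff_isUnit_det, Mbar_three_eq, Matrix.det_reindex_self, Matrix.det_fin_three]
  simp

end PosBraid

theorem mainTheorem11 :
    (IsUnit (PosBraid.Mbar 3) ∧
      (PosBraid.Mbar 3).charpoly =
        (Polynomial.X - Polynomial.C 1) ^ 2 * (Polynomial.X - Polynomial.C 2)) ∧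
    (∀ x : PosBraid 3,
      ((PosBraid.IsSimple x ∧ (PosBraid.part (PosBraid.DL x)).parts = {1, 1, 1}) ↔ x = 1) ∧
      ((PosBraid.IsSimple x ∧ (PosBraid.part (PosBraid.DL x)).parts = {2, 1}) ↔
        x = PosBraid.σ 0 ∨ x = PosBraid.σ 1 ∨
          x = PosBraid.σ 1 * PosBraid.σ 0 ∨ x = PosBraid.σ 0 * PosBraid.σ 1) ∧
      ((PosBraid.IsSimple x ∧ (PosBraid.part (PosBraid.DL x)).parts = {3}) ↔
        x = PosBraid.Δ 3)) ∧
    (∀ d : ℕ, 1 ≤ d →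
      (∀ x : PosBraid 3, PosBraid.IsSimple x →
        ((PosBraid.part (PosBraid.DL x)).parts = {1, 1, 1} →
          (PosBraid.bAt 3 d x : ℤ) = 4 * 2 ^ d - 3 * d - 4) ∧
        ((PosBraid.part (PosBraid.DL x)).parts = {2, 1} →
          (PosBraid.bAt 3 d x : ℤ) = 2 ^ d - 1) ∧
        ((PosBraid.part (PosBraid.DL x)).parts = {3} →
          (PosBraid.bAt 3 d x : ℤ) = 1)) ∧
      (PosBraid.b 3 d : ℤ) = 8 * 2 ^ d - 3 * d - 7) := by
  refine ⟨⟨PosBraid.isUnit_Mbar_three, PosBraid.charpoly_Mbar_three⟩, fun x => ?_, fun d hd => ?_⟩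
  · have key (μ : Multiset ℕ) :
        (PosBraid.IsSimple x ∧ (PosBraid.part (PosBraid.DL x)).parts = μ) ↔
          ∃ s, PosBraid.simple s = x ∧ (![{1, 1, 1}, {2, 1}, {3}] : Fin 3 → Multiset ℕ)
            ((![0, 1, 1, 1, 1, 2] : Fin 6 → Fin 3) s) = μ := by
      rw [PosBraid.isSimple_iff]
      constructor
      · rintro ⟨⟨s, rfl⟩, h⟩
        exact ⟨s, rfl, by rw [← h, PosBraid.part_DL_simple, PosBraid.parts_partitionThree]⟩
      · rintro ⟨s, rfl, h⟩
        exact ⟨⟨s, rfl⟩, by rw [← h, PosBraid.part_DL_simple, PosBraid.parts_partitionThree]⟩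
    have h1 : ∀ s, (![{1, 1, 1}, {2, 1}, {3}] : Fin 3 → Multiset ℕ)
        ((![0, 1, 1, 1, 1, 2] : Fin 6 → Fin 3) s) = {1, 1, 1} ↔ s = 0 := by decide
    have h2 : ∀ s, (![{1, 1, 1}, {2, 1}, {3}] : Fin 3 → Multiset ℕ)
        ((![0, 1, 1, 1, 1, 2] : Fin 6 → Fin 3) s) = {2, 1} ↔ s = 1 ∨ s = 2 ∨ s = 3 ∨ s = 4 := by
      decide
    have h3 : ∀ s, (![{1, 1, 1}, {2, 1}, {3}] : Fin 3 → Multiset ℕ)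
        ((![0, 1, 1, 1, 1, 2] : Fin 6 → Fin 3) s) = {3} ↔ s = 5 := by decide
    simp only [key, h1, h2, h3, and_or_left, exists_or, exists_eq_right, eq_comm (b := x)]
    exact ⟨.rfl, .rfl, .rfl⟩
  -- Here `d` is replaced by `d + 1`, since `seqs d` consists of sequences of length `d + 1`.
  · obtain ⟨d, rfl⟩ := Nat.exists_eq_add_of_le' hd
    refine ⟨fun x hx => ?_, by simpa using PosBraid.b_three d⟩
    obtain ⟨s, rfl⟩ := PosBraid.isSimple_iff.1 hx
    rw [PosBraid.bAt_simple, PosBraid.card_seqs, PosBraid.part_DL_simple,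
      PosBraid.parts_partitionThree]
    push_cast
    fin_cases s
    · exact ⟨fun _ => rfl, fun h => absurd h (by decide), fun h => absurd h (by decide)⟩
    iterate 4
      exact ⟨fun h => absurd h (by decide), fun _ => rfl, fun h => absurd h (by decide)⟩
    exact ⟨fun h => absurd h (by decide), fun h => absurd h (by decide), fun _ => rfl⟩
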